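/- Let $G$ be a countable discrete group and let $(F_n)$, $(W_n)$ be two (left) Følner sequences in $G$, i.e. sequences of non-empty finite sets with $|gF_n\triangle F_n|/|F_n|\to 0$ and $|gW_n\triangle W_n|/|W_n|\to 0$ for every $g\in G$ (so $G$ is amenable). Definitions. For a probability space $(X,\mu)$, a measurable semimetric $\rho$ on $X$ and $\varepsilon>0$, let $\mathbb H_\varepsilon(X,\mu,\rho)=\log_2 k$, where $k\ge 1$ is minimal such that $X$ decomposes into measurable sets $X_0,X_1,\dots,X_k$ with $\mu(X_0)<\varepsilon$ and $\operatorname{diam}_\rho(X_i)<\varepsilon$ for $i\ge1$ ($+\infty$ if there is no such $k$). A semimetric is admissible if it is separable on a set of full measure. For a p.m.p. action $\alpha$ of $G$ on a standard probability space $(X,\mu)$, a semimetric is generating if its translates $\rho(gx,gy)$, $g\in G$, together separate the points of a set of full measure. For functions of $(n,\varepsilon)$ write $\Phi\precsim\Psi$ if for every $\varepsilon>0$ there is $\delta>0$ with $\Phi(n,\varepsilon)=O(\Psi(n,\delta))$ as $n\to\infty$, and $\Phi\asymp\Psi$ if $\Phi\precsim\Psi\precsim\Phi$. With $\lambda=(F_n)$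 the scaling entropy $\mathcal H(\alpha,\lambda)$ is the class of all functions, decreasing in $\varepsilon$, that are $\asymp$-equivalent to $$\Phi_\rho(n,\varepsilon)=\mathbb H_\varepsilon\Big(X,\mu,\ \frac1{|F_n|}\sum_{g\in F_n}\rho(gx,gy)\Big)$$ for some generating summable admissible measurable semimetric $\rho$; $\mathcal H(\alpha,\lambda)\succsim\phi$ means $\phi\precsim\Phi$ for all $\Phi\in\mathcal H(\alpha,\lambda)$, where $\phi(n)$ is regarded as independent of $\varepsilon$. A function $\phi:\mathbb N\to[0,\infty)$ with $\phi(n)\to\infty$ is a gap bound for $\lambda$ if $\mathcal H(\alpha,\lambda)\succsim\phi$ for every (essentially) free p.m.p. action $\alpha$ of $G$ on a standard probability space; $G$ has a scaling entropy growth gap with respect to $\lambda$ if a gap bound for $\lambda$ exists. Proposition. (1) $G$ has a scaling entropy growth gap with respect to $(F_n)$ if and only if it has one with respect to $(W_n)$. (2) There are numbers $k_n$ such that $|F_nW_r\triangle W_r|<2^{-n}|W_r|$ for all $n$ and all $r>k_n$, and they can be chosen so that for all sufficiently large $r$ there is a maximal $n=n(r)$ with $k_n<r$. (3) If $\phi$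 is a gap bound for $(F_n)$, then for any $k_n$ and $n(r)$ as in (2) (with arbitrary values $n(r)$ for the remaining finitely many $r$) the function $\psi(r)=\phi(n(r))$ is a gap bound for $(W_r)$. -/

import Mathlib

open MeasureTheory Filter Topology
open scoped ENNReal NNReal Pointwise symmDiff

/-! ### Measurable semimetrics and epsilon-entropy -/

section Semimetric

variable {X : Type*} [MeasurableSpace X]

/-- A measurable semimetric on `X`. -/
structure IsMeasurableSemimetric (ρ : X → X → ℝ) : Prop where
  measurable : Measurable (Function.uncurry ρ)
  nonneg : ∀ x y, 0 ≤ ρ x y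
  self : ∀ x, ρ x x = 0
  symm : ∀ x y, ρ x y = ρ y x
  triangle : ∀ x y z, ρ x z ≤ ρ x y + ρ y z

/-- The semimetric `ρ` is separable on some measurable set of full measure. -/
def IsAdmissible (μ : Measure X) (ρ : X → X → ℝ) : Prop :=
  ∃ s : Set X, MeasurableSet s ∧ μ sᶜ = 0 ∧
    ∃ t : Set X, t.Countable ∧ t ⊆ s ∧ ∀ x ∈ s, ∀ η : ℝ, 0 < η → ∃ y ∈ t, ρ x y < η

/-- `ρ` belongs to the cone of summable admissible measurable semimetrics on `(X, μ)`. -/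
structure IsAdm (μ : Measure X) (ρ : X → X → ℝ) : Prop where
  semimetric : IsMeasurableSemimetric ρ
  admissible : IsAdmissible μ ρ
  integrable : Integrable (Function.uncurry ρ) (μ.prod μ)

/-- The diameter of a set with respect to `ρ`. -/
noncomputable def semiDiam (ρ : X → X → ℝ) (A : Set X) : ℝ≥0∞ :=
  ⨆ x ∈ A, ⨆ y ∈ A, ENNReal.ofReal (ρ x y)

/-- `X` decomposes into measurable sets `A 0, A 1, …, A k` such that `A 0` has measure less
than `ε` and each of `A 1, …, A k` has `ρ`-diameter less than `ε`. -/
def HasEpsDecomposition (μ : Measure X) (ρ : X → X → ℝ) (ε : ℝ) (k : ℕ) : Prop :=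
  ∃ A : Fin (k + 1) → Set X,
    (∀ i, MeasurableSet (A i)) ∧ Pairwise (fun i j => Disjoint (A i) (A j)) ∧
    (⋃ i, A i) = Set.univ ∧ μ (A 0) < ENNReal.ofReal ε ∧
    ∀ i, i ≠ 0 → semiDiam ρ (A i) < ENNReal.ofReal ε

/-- The `ε`-entropy: `log₂ k` for the minimal positive `k` admitting an `ε`-decomposition,
and `∞` if there is no such `k`. -/
noncomputable def epsEntropy (μ : Measure X) (ρ : X → X → ℝ) (ε : ℝ) : ℝ≥0∞ :=
  ⨅ (k : ℕ) (_ : 1 ≤ k ∧ HasEpsDecomposition μ ρ ε k), ENNReal.ofReal (Real.logb 2 k)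

end Semimetric

/-! ### Scaling entropy of an action -/

/-- The relation `Φ ≾ Ψ` between functions of `(n, ε)`: for every `ε > 0` there is `δ > 0`
with `Φ(n, ε) = O(Ψ(n, δ))`. -/
def AsympLE (Φ Ψ : ℕ → ℝ → ℝ≥0∞) : Prop :=
  ∀ ε : ℝ, 0 < ε → ∃ δ : ℝ, 0 < δ ∧ ∃ C : ℝ≥0, ∀ᶠ n in atTop, Φ n ε ≤ C * Ψ n δ

/-- The equivalence `Φ ≍ Ψ`. -/
def AsympEquiv (Φ Ψ : ℕ → ℝ → ℝ≥0∞) : Prop :=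
  AsympLE Φ Ψ ∧ AsympLE Ψ Φ

section Action

variable {G : Type*} [Group G] {X : Type*} [MulAction G X]

/-- The average of the translates `(x, y) ↦ ρ (g x) (g y)` over `g ∈ S`. -/
noncomputable def avgSemimetric (S : Finset G) (ρ : X → X → ℝ) (x y : X) : ℝ :=
  (S.card : ℝ)⁻¹ * ∑ g ∈ S, ρ (g • x) (g • y)

variable [MeasurableSpace X]

variable (G) in
/-- All translates of `ρ` together separate the points of a set of full measure. -/
def IsGenerating (μ : Measure X) (ρ : X → X → ℝ) : Prop :=
  ∃ s : Set X, MeasurableSet s ∧ μ sᶜ = 0 ∧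
    ∀ x ∈ s, ∀ y ∈ s, x ≠ y → ∃ g : G, 0 < ρ (g • x) (g • y)

variable (G) in
/-- The action is (essentially) free: non-identity elements have null sets of fixed points. -/
def IsFreeAction (μ : Measure X) : Prop :=
  ∀ g : G, g ≠ 1 → μ {x : X | g • x = x} = 0

/-- `Φ_ρ(n, ε)`: the `ε`-entropy of the average of `ρ` over `F n`. -/
noncomputable def entropyFun (μ : Measure X) (F : ℕ → Finset G) (ρ : X → X → ℝ)
    (n : ℕ) (ε : ℝ) : ℝ≥0∞ :=
  epsEntropy μ (avgSemimetric (F n) ρ) ε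

/-- The scaling entropy of a p.m.p. action with respect to the equipment `F`: the class of all
functions of `(n, ε)`, decreasing in `ε > 0`, that are equivalent to `Φ_ρ` for some generating
summable admissible semimetric `ρ`. -/
def scalingEntropy (μ : Measure X) (F : ℕ → Finset G) : Set (ℕ → ℝ → ℝ≥0∞) :=
  {Φ | (∀ n, AntitoneOn (Φ n) (Set.Ioi 0)) ∧
    ∃ ρ : X → X → ℝ, IsAdm μ ρ ∧ IsGenerating G μ ρ ∧ AsympEquiv Φ (entropyFun μ F ρ)}

end Action

/-! ### Følner sequences and growth gap -/

section Gap

variable {G : Type*} [Group G]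

/-- A (left) Følner sequence of non-empty finite subsets of the discrete group `G`. -/
def IsFolnerSequence (F : ℕ → Finset G) : Prop :=
  (∀ n, (F n).Nonempty) ∧
    letI : MeasurableSpace G := ⊤
    IsFoelner G Measure.count atTop (fun n => (F n : Set G))

/-- `φ` tends to infinity and `𝓗(α, F) ≿ φ` for every free p.m.p. action `α` of `G` on a
standard probability space. -/
def IsGapBound (F : ℕ → Finset G) (φ : ℕ → ℝ≥0) : Prop :=
  Tendsto φ atTop atTop ∧
    ∀ (X : Type) [MeasurableSpace X] [StandardBorelSpace X] [MulAction G X]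
      [MeasurableConstSMul G X] (μ : Measure X) [IsProbabilityMeasure μ]
      [SMulInvariantMeasure G X μ],
      IsFreeAction G μ →
        ∀ Φ ∈ scalingEntropy μ F, AsympLE (fun n _ => (φ n : ℝ≥0∞)) Φ

/-- `G` has a scaling entropy growth gap with respect to the equipment `F`. -/
def HasGrowthGap (F : ℕ → Finset G) : Prop :=
  ∃ φ : ℕ → ℝ≥0, IsGapBound F φ

/-- The numbers `k n` satisfy `|F_n W_r ∆ W_r| < 2⁻ⁿ |W_r|` for all `r > k n`. -/
def IsInvarianceThreshold [DecidableEq G] (F W : ℕ → Finset G) (k : ℕ → ℕ) : Prop :=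
  ∀ n r : ℕ, k n < r →
    (((F n * W r) ∆ W r).card : ℝ) < (2 : ℝ)⁻¹ ^ n * ((W r).card : ℝ)

/-- For all sufficiently large `r`, `N r` is the maximal `n` with `k n < r`. -/
def IsMaxIndex (k N : ℕ → ℕ) : Prop :=
  ∀ᶠ r in atTop, IsGreatest {n : ℕ | k n < r} (N r)

end Gap

/-! The heart of the matter is the comparison `HasEpsDecomposition.of_avgSemimetric_le`: if the
average of a semimetric `σ` over a finite set `S ⊆ G` is bounded, up to a small error, by some `τ`
that admits a decomposition into `k` pieces of small diameter, then `σ` itself admits a (coarser)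
decomposition into `k` pieces. Indeed, choose a point in every piece; the `τ`-distance of `x` to
the chosen point of its piece is small, so the `σ`-distance of `g x` to its translate is small in
the mean over `x` for at least one `g ∈ S`. By Markov's inequality it is small off a set of small
measure, and since `g` preserves the measure, the decomposition may be transported by `g`.

This is applied with `S = W r`, `σ` the average of `ρ` over `F n` and `τ` the average of `ρ` over
`W r`. When `ρ ≤ 1` and `W r` is almost invariant under `F n`, the average of `σ` over `W r`
exceeds `τ` by at most `|F n * W r ∆ W r| / |W r|` (`avgSemimetric_avgSemimetric_le`). The
restriction `ρ ≤ 1` is harmless: replacing `ρ` by `min ρ 1` keeps it generating, summable and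
admissible, and does not increase the entropy. Hence `Φ_ρ` with respect to `W` at `r` dominates
`Φ_{min ρ 1}` with respect to `F` at `n = N r`, and a gap bound `φ` for `F` yields the gap bound
`φ ∘ N` for `W` (`IsGapBound.comp_isMaxIndex`). Thresholds exist because `F n * W r ∆ W r` is
covered by the finitely many sets `g • W r ∆ W r`, `g ∈ F n`; taking them to grow with `n` provides `N`. -/

/-! ### Monotonicity of the entropy -/

section Entropy

variable {X : Type*}

lemma semiDiam_mono {ρ σ : X → X → ℝ} (h : ∀ x y, ρ x y ≤ σ x y) (A : Set X) :
    semiDiam ρ A ≤ semiDiam σ A :=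
  iSup₂_mono fun x _ => iSup₂_mono fun y _ => ENNReal.ofReal_le_ofReal (h x y)

lemma le_of_semiDiam_lt {ρ : X → X → ℝ} {A : Set X} {ε : ℝ}
    (h : semiDiam ρ A < ENNReal.ofReal ε) {x y : X} (hx : x ∈ A) (hy : y ∈ A) : ρ x y ≤ ε := by
  have h1 : ENNReal.ofReal (ρ x y) ≤ semiDiam ρ A :=
    le_iSup₂_of_le x hx (le_iSup₂_of_le y hy le_rfl)
  exact (ENNReal.ofReal_lt_ofReal_iff'.1 (h1.trans_lt h)).1.le

lemma semiDiam_lt_of_le {ρ : X → X → ℝ} {A : Set X} {c ε : ℝ} (hε : 0 < ε) (hc : c < ε)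
    (h : ∀ x ∈ A, ∀ y ∈ A, ρ x y ≤ c) : semiDiam ρ A < ENNReal.ofReal ε :=
  (iSup₂_le fun x hx => iSup₂_le fun y hy => ENNReal.ofReal_le_ofReal (h x hx y hy)).trans_lt
    ((ENNReal.ofReal_lt_ofReal_iff hε).2 hc)

variable [MeasurableSpace X] {μ : Measure X}

lemma HasEpsDecomposition.mono {ρ σ : X → X → ℝ} (h : ∀ x y, ρ x y ≤ σ x y) {δ ε : ℝ}
    (hδ : δ ≤ ε) {k : ℕ} (hk : HasEpsDecomposition μ σ δ k) : HasEpsDecomposition μ ρ ε k := by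
  obtain ⟨A, hm, hd, hu, h0, hi⟩ := hk
  have hle := ENNReal.ofReal_le_ofReal hδ
  exact ⟨A, hm, hd, hu, h0.trans_le hle,
    fun i hne => (semiDiam_mono h (A i)).trans_lt ((hi i hne).trans_le hle)⟩

lemma epsEntropy_le_of_forall {ρ σ : X → X → ℝ} {δ ε : ℝ}
    (h : ∀ k, HasEpsDecomposition μ σ δ k → HasEpsDecomposition μ ρ ε k) :
    epsEntropy μ ρ ε ≤ epsEntropy μ σ δ :=
  le_iInf₂ fun k hk => iInf₂_le k ⟨hk.1, h k hk.2⟩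

end Entropy

/-! ### Truncation of semimetrics -/

section Truncation

variable {X : Type*} [MeasurableSpace X] {μ : Measure X} {ρ : X → X → ℝ}

lemma IsAdm.min_one [IsFiniteMeasure μ] (h : IsAdm μ ρ) :
    IsAdm μ (fun x y => min (ρ x y) 1) where
  semimetric :=
    { measurable := h.semimetric.measurable.min measurable_const
      nonneg := fun x y => le_min (h.semimetric.nonneg x y) zero_le_one
      self := fun x => by simp [h.semimetric.self]
      symm := fun x y => by rw [h.semimetric.symm]
      triangle := fun x y z => by
        have h1 := h.semimetric.triangle x y z
        have h2 := h.semimetric.nonneg x y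
        have h3 := h.semimetric.nonneg y z
        grind }
  admissible := by
    obtain ⟨s, hs, hs0, t, ht, hts, hd⟩ := h.admissible
    refine ⟨s, hs, hs0, t, ht, hts, fun x hx η hη => ?_⟩
    obtain ⟨y, hy, hxy⟩ := hd x hx η hη
    exact ⟨y, hy, (min_le_left _ _).trans_lt hxy⟩
  integrable := by
    refine Integrable.of_bound
      (h.semimetric.measurable.min measurable_const).aestronglyMeasurable 1 ?_
    filter_upwards with p
    have h1 := h.semimetric.nonneg p.1 p.2
    change ‖min (ρ p.1 p.2) 1‖ ≤ 1
    rw [Real.norm_eq_abs, abs_of_nonneg (le_min h1 zero_le_one)]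
    exact min_le_right _ _

lemma IsGenerating.min_one {G : Type*} [Group G] [MulAction G X] (h : IsGenerating G μ ρ) :
    IsGenerating G μ (fun x y => min (ρ x y) 1) := by
  obtain ⟨s, hs, hs0, hg⟩ := h
  refine ⟨s, hs, hs0, fun x hx y hy hxy => ?_⟩
  obtain ⟨g, hg⟩ := hg x hx y hy hxy
  exact ⟨g, lt_min hg one_pos⟩

end Truncation

/-! ### Averages of semimetrics -/

section Average

variable {G : Type*} [Group G] {X : Type*} [MulAction G X]

lemma avgSemimetric_mono {ρ σ : X → X → ℝ} (h : ∀ x y, ρ x y ≤ σ x y) (S : Finset G) (x y : X) :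
    avgSemimetric S ρ x y ≤ avgSemimetric S σ x y :=
  mul_le_mul_of_nonneg_left (Finset.sum_le_sum fun g _ => h _ _) (by positivity)

lemma IsMeasurableSemimetric.avgSemimetric [MeasurableSpace X] [MeasurableConstSMul G X]
    {ρ : X → X → ℝ} (h : IsMeasurableSemimetric ρ) (S : Finset G) :
    IsMeasurableSemimetric (avgSemimetric S ρ) where
  measurable := by
    have : ∀ g : G, Measurable fun p : X × X => ρ (g • p.1) (g • p.2) := fun g =>
      h.measurable.comp ((measurable_fst.const_smul g).prodMk (measurable_snd.const_smul g))
    exact (Finset.measurable_fun_sum S fun g _ => this g).const_mul _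
  nonneg x y := mul_nonneg (by positivity) (Finset.sum_nonneg fun g _ => h.nonneg _ _)
  self x := by simp [_root_.avgSemimetric, h.self]
  symm x y := by simp only [_root_.avgSemimetric, h.symm]
  triangle x y z := by
    simp only [_root_.avgSemimetric, ← mul_add, ← Finset.sum_add_distrib]
    exact mul_le_mul_of_nonneg_left (Finset.sum_le_sum fun g _ => h.triangle _ _ _) (by positivity)

/-- For a function with values in `[0, 1]`, translating the domain of summation `T` by an element
of `S` increases the sum by at most the number of points of `S * T` outside `T`. -/
lemma sum_mul_left_le_add_card [DecidableEq G] {S T : Finset G} {s : G} (hs : s ∈ S) {f : G → ℝ}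
    (h0 : ∀ g, 0 ≤ f g) (h1 : ∀ g, f g ≤ 1) :
    ∑ t ∈ T, f (s * t) ≤ ∑ t ∈ T, f t + ((S * T) ∆ T).card := by
  have hsub : s • T ⊆ T ∪ (S * T) ∆ T := by
    intro x hx
    have hx' : x ∈ S * T := Finset.smul_finset_subset_mul hs hx
    by_cases hT : x ∈ T <;> simp [Finset.mem_symmDiff, hT, hx']
  calc ∑ t ∈ T, f (s * t) = ∑ g ∈ s • T, f g := by
        rw [Finset.smul_finset_def, Finset.sum_image fun a _ b _ h => smul_left_cancel s h]
        simp
    _ ≤ ∑ g ∈ T ∪ (S * T) ∆ T, f g :=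
        Finset.sum_le_sum_of_subset_of_nonneg hsub fun g _ _ => h0 g
    _ ≤ ∑ g ∈ T, f g + ∑ g ∈ (S * T) ∆ T, f g := by
        rw [← Finset.sum_union_inter]
        exact le_add_of_nonneg_right (Finset.sum_nonneg fun g _ => h0 g)
    _ ≤ ∑ t ∈ T, f t + ((S * T) ∆ T).card := by
        gcongr
        simpa using Finset.sum_le_sum fun g (_ : g ∈ (S * T) ∆ T) => h1 g

lemma avgSemimetric_avgSemimetric_le [DecidableEq G] {S T : Finset G} (hT : T.Nonempty)
    {ρ : X → X → ℝ} (h0 : ∀ x y, 0 ≤ ρ x y) (h1 : ∀ x y, ρ x y ≤ 1) {c : ℝ} (hc0 : 0 ≤ c)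
    (hc : (((S * T) ∆ T).card : ℝ) ≤ c * T.card) (x y : X) :
    avgSemimetric T (avgSemimetric S ρ) x y ≤ avgSemimetric T ρ x y + c := by
  have hTpos : (0 : ℝ) < T.card := by exact_mod_cast hT.card_pos
  set a := ∑ t ∈ T, ρ (t • x) (t • y) with ha
  have ha0 : 0 ≤ a := Finset.sum_nonneg fun t _ => h0 _ _
  have key : ∑ s ∈ S, ∑ t ∈ T, ρ (s • t • x) (s • t • y) ≤ S.card * (a + c * T.card) := by
    rw [← nsmul_eq_mul]
    refine Finset.sum_le_card_nsmul _ _ _ fun s hs => ?_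
    have := sum_mul_left_le_add_card (T := T) hs (f := fun g => ρ (g • x) (g • y))
      (fun _ => h0 _ _) (fun _ => h1 _ _)
    simp only [mul_smul] at this
    exact this.trans (add_le_add le_rfl hc)
  -- The junk value `0⁻¹ = 0` makes the inequality trivial for empty `S`.
  have hS : (S.card : ℝ)⁻¹ * (S.card * (a + c * T.card)) ≤ a + c * T.card := by
    have hnn : 0 ≤ a + c * T.card := by positivity
    rw [← mul_assoc]
    exact mul_le_of_le_one_left hnn (inv_mul_le_one (a := (S.card : ℝ)))
  calc avgSemimetric T (avgSemimetric S ρ) x y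
      = (T.card : ℝ)⁻¹ * ((S.card : ℝ)⁻¹ * ∑ s ∈ S, ∑ t ∈ T, ρ (s • t • x) (s • t • y)) := by
        simp only [avgSemimetric]
        rw [← Finset.mul_sum, Finset.sum_comm]
    _ ≤ (T.card : ℝ)⁻¹ * (a + c * T.card) := by
        refine mul_le_mul_of_nonneg_left (le_trans ?_ hS) (by positivity)
        exact mul_le_mul_of_nonneg_left key (by positivity)
    _ = avgSemimetric T ρ x y + c := by
        simp only [avgSemimetric, ← ha]
        field_simp

end Average

/-! ### Decompositions for a semimetric and for its averages -/

/-- If the mean over `S` of nonnegative functions is at most `c` on a set `E`, then Markov's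
inequality with this bound holds on `E` for at least one of them. -/
lemma exists_measure_inter_le {ι X : Type*} [MeasurableSpace X] {μ : Measure X}
    [IsProbabilityMeasure μ] {S : Finset ι} (hS : S.Nonempty) {f : ι → X → ℝ}
    (hfm : ∀ i, Measurable (f i)) (hf0 : ∀ i x, 0 ≤ f i x) {c : ℝ} {E : Set X}
    (hsum : ∀ x ∈ E, ∑ i ∈ S, f i x ≤ S.card * c) {t : ℝ} (ht : 0 < t) :
    ∃ i ∈ S, μ (E ∩ {x | t ≤ f i x}) ≤ ENNReal.ofReal (c / t) := by
  obtain ⟨i, hi, hic⟩ : ∃ i ∈ S, ∫⁻ x in E, ENNReal.ofReal (f i x) ∂μ ≤ ENNReal.ofReal c := by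
    refine ENNReal.exists_le_of_sum_le hS ?_
    rw [← lintegral_finsetSum _ fun i _ => (hfm i).ennreal_ofReal]
    calc ∫⁻ x in E, ∑ i ∈ S, ENNReal.ofReal (f i x) ∂μ
        ≤ ∫⁻ x in E, ENNReal.ofReal (S.card * c) ∂μ := by
          refine setLIntegral_mono measurable_const fun x hx => ?_
          rw [← ENNReal.ofReal_sum_of_nonneg fun i _ => hf0 i x]
          exact ENNReal.ofReal_le_ofReal (hsum x hx)
      _ ≤ ENNReal.ofReal (S.card * c) := by
          rw [lintegral_const, Measure.restrict_apply_univ]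
          exact mul_le_of_le_one_right' prob_le_one
      _ = ∑ _i ∈ S, ENNReal.ofReal c := by
          rw [Finset.sum_const, nsmul_eq_mul, ENNReal.ofReal_mul (Nat.cast_nonneg _),
            ENNReal.ofReal_natCast]
  refine ⟨i, hi, ?_⟩
  have hset : μ (E ∩ {x | t ≤ f i x})
      ≤ μ.restrict E {x | ENNReal.ofReal t ≤ ENNReal.ofReal (f i x)} := by
    rw [Set.inter_comm, ← Measure.restrict_apply (measurableSet_le measurable_const (hfm i))]
    exact measure_mono fun x hx => ENNReal.ofReal_le_ofReal hx
  rw [ENNReal.ofReal_div_of_pos ht]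
  refine hset.trans ((meas_ge_le_lintegral_div (hfm i).ennreal_ofReal.aemeasurable
    (ENNReal.ofReal_pos.2 ht).ne' ENNReal.ofReal_ne_top).trans ?_)
  gcongr

section Comparison

variable {G : Type*} [Group G] {X : Type*} [MulAction G X] [MeasurableSpace X]
  [MeasurableConstSMul G X] {μ : Measure X} [SMulInvariantMeasure G X μ]

/-- Decompositions may be transported by a measure-preserving transformation. -/
lemma HasEpsDecomposition.of_smul {ρ : X → X → ℝ} {ε : ℝ} {k : ℕ} (g : G)
    (h : HasEpsDecomposition μ (fun x y => ρ (g • x) (g • y)) ε k) :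
    HasEpsDecomposition μ ρ ε k := by
  obtain ⟨A, hm, hd, hu, h0, hi⟩ := h
  refine ⟨fun i => (fun x => g⁻¹ • x) ⁻¹' A i, fun i => measurable_const_smul g⁻¹ (hm i),
    fun i j hij => (hd hij).preimage _, ?_, ?_, fun i hne => ?_⟩
  · rw [← Set.preimage_iUnion, hu, Set.preimage_univ]
  · simpa only [measure_preimage_smul] using h0
  · refine lt_of_le_of_lt (iSup₂_le fun x hx => iSup₂_le fun y hy => ?_) (hi i hne)
    refine le_iSup₂_of_le (g⁻¹ • x) hx (le_iSup₂_of_le (g⁻¹ • y) hy ?_)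
    simp

/-- A measurable map moving most points by little in `σ` and having at most one value on each
piece of a partition yields a decomposition for `σ`: discard the points moved too far. -/
lemma HasEpsDecomposition.of_close_to_points {σ : X → X → ℝ} (hσ : IsMeasurableSemimetric σ)
    {k : ℕ} {A : Fin (k + 1) → Set X} (hm : ∀ i, MeasurableSet (A i))
    (hd : Pairwise fun i j => Disjoint (A i) (A j)) (hu : ⋃ i, A i = Set.univ)
    {p : X → X} {q : Fin (k + 1) → X} (hq : ∀ i, ∀ x ∈ A i, p x = q i)
    {η ε : ℝ} (hε : 0 < ε) (hη : 2 * η < ε) {B : Set X} (hB : MeasurableSet B)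
    (hBp : ∀ x ∉ B, x ∉ A 0 → σ x (p x) ≤ η) (hμ : μ (A 0 ∪ B) < ENNReal.ofReal ε) :
    HasEpsDecomposition μ σ ε k := by
  refine ⟨fun i => if i = 0 then A 0 ∪ B else A i \ B, fun i => ?_, fun i j hij => ?_, ?_, ?_,
    fun i hi => ?_⟩
  · beta_reduce
    split_ifs
    exacts [(hm 0).union hB, (hm i).diff hB]
  · have h0 : ∀ j, j ≠ 0 → Disjoint (A 0 ∪ B) (A j \ B) := fun j hj =>
      Set.disjoint_union_left.2
        ⟨(hd (Ne.symm hj)).mono_right Set.sdiff_subset, Set.disjoint_sdiff_right⟩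
    by_cases hi : i = 0
    · have hj : j ≠ 0 := fun hj => hij (hi.trans hj.symm)
      simpa [hi, hj] using h0 j hj
    · by_cases hj : j = 0
      · simpa [hi, hj] using (h0 i hi).symm
      · simpa [hi, hj] using (hd hij).mono Set.sdiff_subset Set.sdiff_subset
  · refine Set.eq_univ_of_forall fun x => ?_
    obtain ⟨i, hi⟩ := Set.mem_iUnion.1 (hu ▸ Set.mem_univ x)
    by_cases hx : i = 0 ∨ x ∈ B
    · refine Set.mem_iUnion.2 ⟨0, ?_⟩
      rcases hx with rfl | hx
      · simp [hi]
      · simp [hx]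
    · push Not at hx
      exact Set.mem_iUnion.2 ⟨i, by simp [hx.1, hx.2, hi]⟩
  · simpa using hμ
  · simp only [hi, if_false]
    refine semiDiam_lt_of_le hε hη fun x hx y hy => ?_
    have hnot : ∀ z ∈ A i, z ∉ A 0 := fun z hz => Set.disjoint_left.1 (hd hi) hz
    have h1 := hBp x hx.2 (hnot x hx.1)
    have h2 := hBp y hy.2 (hnot y hy.1)
    rw [hq i x hx.1] at h1
    rw [hq i y hy.1, hσ.symm] at h2
    linarith [hσ.triangle x (q i) y]

/-- If the average of `σ` over `S` is at most `τ + δ`, a decomposition for `τ` at a small scale `δ`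
gives a decomposition for `σ` at scale `ε` with the same number of pieces. -/
lemma HasEpsDecomposition.of_avgSemimetric_le [IsProbabilityMeasure μ] {S : Finset G}
    (hS : S.Nonempty) {σ τ : X → X → ℝ} (hσ : IsMeasurableSemimetric σ) {ε δ : ℝ} (hε : 0 < ε)
    (hδ : 0 < δ) (hδε : δ * (1 + 8 / ε) ≤ ε)
    (h : ∀ x y, avgSemimetric S σ x y ≤ τ x y + δ) {k : ℕ} (hk : HasEpsDecomposition μ τ δ k) :
    HasEpsDecomposition μ σ ε k := by
  obtain ⟨A, hm, hd, hu, h0, hi⟩ := hk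
  have : Nonempty X := nonempty_of_isProbabilityMeasure μ
  have hSpos : (0 : ℝ) < S.card := by exact_mod_cast hS.card_pos
  have hι : ∀ x, ∃ i, x ∈ A i := fun x => Set.mem_iUnion.1 (hu ▸ Set.mem_univ x)
  choose ι hι using hι
  have hιeq : ∀ i x, x ∈ A i → ι x = i := fun i x hx => by
    by_contra hne
    exact Set.disjoint_left.1 (hd hne) (hι x) hx
  have hιm : Measurable ι := by
    refine measurable_to_countable' fun i => ?_
    convert hm i using 1
    ext x
    exact ⟨fun hx => hx ▸ hι x, fun hx => hιeq i x hx⟩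
  -- The chosen points; those of empty pieces play no role.
  have hq : ∀ i, ∃ y, ∀ x ∈ A i, y ∈ A i := fun i => by
    rcases (A i).eq_empty_or_nonempty with he | ⟨y, hy⟩
    · exact ⟨Classical.arbitrary X, by simp [he]⟩
    · exact ⟨y, fun _ _ => hy⟩
  choose q hq using hq
  have hpm : Measurable fun x => q (ι x) := (measurable_of_countable q).comp hιm
  have hfm : ∀ g : G, Measurable fun x => σ (g • x) (g • q (ι x)) := fun g =>
    hσ.measurable.comp ((measurable_id.const_smul g).prodMk (hpm.const_smul g))
  have hsum : ∀ x ∈ (A 0)ᶜ, ∑ g ∈ S, σ (g • x) (g • q (ι x)) ≤ S.card * (2 * δ) := by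
    intro x hx
    have hne : ι x ≠ 0 := fun h0 => hx (h0 ▸ hι x)
    have h1 : τ x (q (ι x)) ≤ δ := le_of_semiDiam_lt (hi _ hne) (hι x) (hq _ x (hι x))
    have h2 := (h x (q (ι x))).trans (add_le_add h1 le_rfl)
    rw [avgSemimetric, inv_mul_le_iff₀ hSpos] at h2
    linarith
  -- The threshold `ε / 4` makes the diameters at most `ε / 2`; the removed set then has measure
  -- less than `δ + 2 * δ / (ε / 4)`, which is where the condition on `δ` comes from.
  obtain ⟨g, -, hg⟩ := exists_measure_inter_le (μ := μ) hS hfm (fun _ _ => hσ.nonneg _ _) hsum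
    (t := ε / 4) (by positivity)
  have hσg : IsMeasurableSemimetric fun x y => σ (g • x) (g • y) :=
    { measurable := hσ.measurable.comp
        ((measurable_fst.const_smul g).prodMk (measurable_snd.const_smul g))
      nonneg := fun _ _ => hσ.nonneg _ _
      self := fun _ => hσ.self _
      symm := fun _ _ => hσ.symm _ _
      triangle := fun _ _ _ => hσ.triangle _ _ _ }
  refine HasEpsDecomposition.of_smul g ?_
  refine HasEpsDecomposition.of_close_to_points hσg hm hd hu (p := fun x => q (ι x)) (q := q)
    (B := (A 0)ᶜ ∩ {x | ε / 4 ≤ σ (g • x) (g • q (ι x))})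
    (fun i x hx => by rw [hιeq i x hx]) hε (η := ε / 4) (by linarith)
    ((hm 0).compl.inter (measurableSet_le measurable_const (hfm g))) ?_ ?_
  · intro x hx hx0
    by_contra hlt
    exact hx ⟨hx0, (not_le.1 hlt).le⟩
  · have hsc : δ + 2 * δ / (ε / 4) = δ * (1 + 8 / ε) := by
      field_simp
      norm_num
    refine (measure_union_le _ _).trans_lt ?_
    refine (ENNReal.add_lt_add_of_lt_of_le (measure_ne_top μ _) h0 hg).trans_le ?_
    rw [← ENNReal.ofReal_add hδ.le (by positivity), hsc]
    exact ENNReal.ofReal_le_ofReal hδε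

end Comparison

/-! ### Invariance thresholds for Følner sequences -/

section Folner

variable {G : Type*} [Group G] [DecidableEq G] {F W : ℕ → Finset G}

lemma IsFolnerSequence.eventually_card_symmDiff_le (hW : IsFolnerSequence W) (g : G) {η : ℝ}
    (hη : 0 < η) :
    ∀ᶠ r in atTop, (((g • W r) ∆ W r).card : ℝ) ≤ η * (W r).card := by
  let : MeasurableSpace G := ⊤
  have ht := hW.2.tendsto_meas_smul_symmDiff g
  filter_upwards [ht.eventually_lt_const (ENNReal.ofReal_pos.2 hη)] with r hr
  have hpos : (0 : ℝ) < (W r).card := by exact_mod_cast (hW.1 r).card_pos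
  have hset : (g • (W r : Set G)) ∆ (W r : Set G) = ((g • W r) ∆ W r : Finset G) := by
    simp [Finset.coe_symmDiff]
  rw [hset, Measure.count_apply_finset, Measure.count_apply_finset,
    ← ENNReal.ofReal_natCast, ← ENNReal.ofReal_natCast, ← ENNReal.ofReal_div_of_pos hpos,
    ENNReal.ofReal_lt_ofReal_iff hη, div_lt_iff₀ hpos] at hr
  exact hr.le

lemma mul_symmDiff_subset_biUnion {S T : Finset G} (hS : S.Nonempty) :
    (S * T) ∆ T ⊆ S.biUnion fun s => (s • T) ∆ T := by
  intro x hx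
  rw [Finset.mem_biUnion]
  rcases Finset.mem_symmDiff.1 hx with ⟨hx, hxT⟩ | ⟨hxT, hx⟩
  · obtain ⟨s, hs, t, ht, rfl⟩ := Finset.mem_mul.1 hx
    exact ⟨s, hs, Finset.mem_symmDiff.2 (Or.inl ⟨Finset.smul_mem_smul_finset ht, hxT⟩)⟩
  · obtain ⟨s, hs⟩ := hS
    exact ⟨s, hs, Finset.mem_symmDiff.2
      (Or.inr ⟨hxT, fun h => hx (Finset.smul_finset_subset_mul hs h)⟩)⟩

lemma IsFolnerSequence.eventually_card_mul_symmDiff_lt (hW : IsFolnerSequence W) {S : Finset G}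
    (hS : S.Nonempty) {η : ℝ} (hη : 0 < η) :
    ∀ᶠ r in atTop, (((S * W r) ∆ W r).card : ℝ) < η * (W r).card := by
  have hSpos : (0 : ℝ) < S.card := by exact_mod_cast hS.card_pos
  have hev := (Filter.eventually_all_finset S).2 fun s _ =>
    hW.eventually_card_symmDiff_le s (η := η / (2 * S.card)) (by positivity)
  filter_upwards [hev] with r hr
  have hpos : (0 : ℝ) < (W r).card := by exact_mod_cast (hW.1 r).card_pos
  calc (((S * W r) ∆ W r).card : ℝ)
      ≤ ∑ s ∈ S, (((s • W r) ∆ W r).card : ℝ) := by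
        exact_mod_cast (Finset.card_le_card (mul_symmDiff_subset_biUnion hS)).trans
          Finset.card_biUnion_le
    _ ≤ S.card • (η / (2 * S.card) * (W r).card) := Finset.sum_le_card_nsmul _ _ _ hr
    _ = η * (W r).card / 2 := by
        rw [nsmul_eq_mul]
        field_simp
    _ < η * (W r).card := half_lt_self (by positivity)

lemma exists_isInvarianceThreshold (hF : IsFolnerSequence F) (hW : IsFolnerSequence W) :
    ∃ k N : ℕ → ℕ, IsInvarianceThreshold F W k ∧ IsMaxIndex k N := by
  have hex : ∀ n, ∃ a : ℕ, ∀ r, a ≤ r →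
      (((F n * W r) ∆ W r).card : ℝ) < (2 : ℝ)⁻¹ ^ n * ((W r).card : ℝ) := fun n =>
    eventually_atTop.1 (hW.eventually_card_mul_symmDiff_lt (hF.1 n) (by positivity))
  choose a ha using hex
  -- Adding `n` makes `k` tend to infinity, so that `{n | k n < r}` is bounded.
  refine ⟨fun n => a n + n, fun r => sSup {n | a n + n < r},
    fun n r (hr : a n + n < r) => ha n r (by omega), ?_⟩
  filter_upwards [eventually_gt_atTop (a 0 + 0)] with r hr
  have hbdd : BddAbove {n | a n + n < r} := ⟨r, fun n (hn : a n + n < r) => by omega⟩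
  exact ⟨Nat.sSup_mem ⟨0, hr⟩ hbdd, fun n hn => le_csSup hbdd hn⟩

lemma IsMaxIndex.tendsto_atTop {k N : ℕ → ℕ} (h : IsMaxIndex k N) : Tendsto N atTop atTop := by
  refine Filter.tendsto_atTop.2 fun m => ?_
  filter_upwards [h, eventually_gt_atTop (k m)] with r hr hm
  exact hr.2 hm

end Folner

/-! ### Transfer of gap bounds -/

section Transfer

lemma entropyFun_mem_scalingEntropy {G : Type*} [Group G] {X : Type*} [MulAction G X]
    [MeasurableSpace X] {μ : Measure X} {ρ : X → X → ℝ} (F : ℕ → Finset G) (hρ : IsAdm μ ρ)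
    (hg : IsGenerating G μ ρ) : entropyFun μ F ρ ∈ scalingEntropy μ F := by
  have hrefl : AsympLE (entropyFun μ F ρ) (entropyFun μ F ρ) := fun ε hε =>
    ⟨ε, hε, 1, Eventually.of_forall fun n => by simp⟩
  exact ⟨fun n δ _ ε _ h => epsEntropy_le_of_forall fun k hk => hk.mono (fun _ _ => le_rfl) h,
    ρ, hρ, hg, hrefl, hrefl⟩

variable {G : Type*} [Group G] [DecidableEq G] {F W : ℕ → Finset G}

/-- The entropy of `min ρ 1` along `F` at `N r` is dominated by the entropy of `ρ` along `W` at
`r`, for a scale `δ` depending only on `ε`. -/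
lemma exists_entropyFun_min_one_le {X : Type*} [MulAction G X] [MeasurableSpace X]
    [MeasurableConstSMul G X] {μ : Measure X} [IsProbabilityMeasure μ] [SMulInvariantMeasure G X μ]
    {ρ : X → X → ℝ} (hρ : IsAdm μ ρ) (hW : IsFolnerSequence W) {k N : ℕ → ℕ}
    (hk : IsInvarianceThreshold F W k) (hN : IsMaxIndex k N) {ε : ℝ} (hε : 0 < ε) :
    ∃ δ : ℝ, 0 < δ ∧ ∀ᶠ r in atTop,
      entropyFun μ F (fun x y => min (ρ x y) 1) (N r) ε ≤ entropyFun μ W ρ r δ := by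
  have hρ' := hρ.min_one.semimetric
  have hδ : 0 < ε / (1 + 8 / ε) := by positivity
  refine ⟨ε / (1 + 8 / ε), hδ, ?_⟩
  have hpow : Tendsto (fun r => (2 : ℝ)⁻¹ ^ N r) atTop (𝓝 0) :=
    (tendsto_pow_atTop_nhds_zero_of_lt_one (by norm_num) (by norm_num)).comp hN.tendsto_atTop
  filter_upwards [hN, hpow.eventually_le_const hδ] with r hr hr2
  refine epsEntropy_le_of_forall fun m hm => ?_
  refine HasEpsDecomposition.of_avgSemimetric_le (hW.1 r) (hρ'.avgSemimetric (F (N r))) hε hδ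
    (div_mul_cancel₀ _ (by positivity)).le (fun x y => ?_) hm
  have h1 := avgSemimetric_avgSemimetric_le (S := F (N r)) (hW.1 r) hρ'.nonneg
    (fun _ _ => min_le_right _ _) (by positivity) (hk (N r) r hr.1).le x y
  have h2 := avgSemimetric_mono (fun x y => min_le_left (ρ x y) 1) (W r) x y
  linarith

lemma IsGapBound.comp_isMaxIndex (hW : IsFolnerSequence W) {φ : ℕ → ℝ≥0} (hφ : IsGapBound F φ)
    {k N : ℕ → ℕ} (hk : IsInvarianceThreshold F W k) (hN : IsMaxIndex k N) :
    IsGapBound W (fun r => φ (N r)) := by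
  refine ⟨hφ.1.comp hN.tendsto_atTop, ?_⟩
  intro X _ _ _ _ μ _ _ hfree Φ ⟨_, ρ, hρ, hg, _, hle⟩ ε hε
  obtain ⟨δ₁, hδ₁, C₁, h₁⟩ := hφ.2 X μ hfree _
    (entropyFun_mem_scalingEntropy F hρ.min_one hg.min_one) ε hε
  obtain ⟨δ₂, hδ₂, h₂⟩ := exists_entropyFun_min_one_le hρ hW hk hN hδ₁
  obtain ⟨δ₃, hδ₃, C₃, h₃⟩ := hle δ₂ hδ₂
  refine ⟨δ₃, hδ₃, C₁ * C₃, ?_⟩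
  filter_upwards [hN.tendsto_atTop.eventually h₁, h₂, h₃] with r hr₁ hr₂ hr₃
  calc (φ (N r) : ℝ≥0∞) ≤ C₁ * (C₃ * Φ r δ₃) := by grw [hr₁, hr₂, hr₃]
    _ = (C₁ * C₃ : ℝ≥0) * Φ r δ₃ := by rw [ENNReal.coe_mul, mul_assoc]

lemma HasGrowthGap.of_isFolnerSequence (hF : IsFolnerSequence F) (hW : IsFolnerSequence W)
    (h : HasGrowthGap F) : HasGrowthGap W := by
  obtain ⟨φ, hφ⟩ := h
  obtain ⟨k, N, hk, hN⟩ := exists_isInvarianceThreshold hF hW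
  exact ⟨_, hφ.comp_isMaxIndex hW hk hN⟩

end Transfer

theorem mainTheorem8 {G : Type*} [Group G] [Countable G] [DecidableEq G]
    (F W : ℕ → Finset G) (hF : IsFolnerSequence F) (hW : IsFolnerSequence W) :
    (HasGrowthGap F ↔ HasGrowthGap W) ∧
    (∃ k N : ℕ → ℕ, IsInvarianceThreshold F W k ∧ IsMaxIndex k N) ∧
    (∀ φ : ℕ → ℝ≥0, IsGapBound F φ →
      ∀ k N : ℕ → ℕ, IsInvarianceThreshold F W k → IsMaxIndex k N →
        IsGapBound W (fun r => φ (N r))) :=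
  ⟨⟨.of_isFolnerSequence hF hW, .of_isFolnerSequence hW hF⟩, exists_isInvarianceThreshold hF hW,
    fun _ hφ _ _ hk hN => hφ.comp_isMaxIndex hW hk hN⟩
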